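/- Let $(T,\mathcal A,\mu)$ be a $\sigma$-finite measure space (with $\mathcal A$ a $\sigma$-algebra and $\mu$ nonnegative and countably additive), let $X$ be a real Banach space, and let $cwk(X)$ be the family of nonempty convex weakly compact subsets of $X$. Let $F:T\to cwk(X)$ be bounded, i.e. there is $M\ge 0$ with $\|x\|\le M$ for all $t\in T$ and $x\in F(t)$. Let $h$ be the Hausdorff distance; finite sums of sets are closures of Minkowski sums. A *countable partition* of $T$ is a sequence $(A_n)_{n\in\mathbb N}$ of pairwise disjoint measurable sets of finite measure with union $T$; empty sets are allowed, choices of points $t_n\in A_n$ are made only in the nonempty sets, and an empty set contributes the term $0$ to each sum below. A partition is *finer* than another if each of its sets is included in some set of the other. Suppose that $F$ is *simple-Birkhoff integrable* in $cwk(X)$: there is $I\in cwk(X)$ such that for every $\varepsilon>0$ there is a countable partition $P_\varepsilon$ of $T$ such that, for every countable partition $(A_n)$ finer than $P_\varepsilon$ and every choice of points $t_n\in A_n$, $$\limsup_{n\to\infty} h\Big(\sum_{i=1}^n F(t_i)\mu(A_i),\,I\Big)\le\varepsilon .$$ Then $F$ is *Birkhoff integrable*: the function $f=j\circ F:T\to\ell_\infty(B_{X^*})$,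 where $j(A)(x^*)=\sup_{x\in A}x^*(x)$ for $A\in cwk(X)$ and $x^*$ in the closed dual unit ball $B_{X^*}$, is Birkhoff integrable. That is, for every $\varepsilon>0$ there is a countable partition $(A_n)$ of $T$ such that $f$ is bounded on each $A_n$ with $\mu(A_n)>0$, every series $\sum_n f(t_n)\mu(A_n)$ with $t_n\in A_n$ converges unconditionally, and the set of the sums of all these series has norm diameter less than $\varepsilon$. -/

import Mathlib

open scoped Pointwise ENNReal

namespace SimpleBirkhoff

/-- The family `cwk(X)` of all nonempty, convex, weakly compact subsets of `X`. -/
def cwk (X : Type*) [NormedAddCommGroup X] [NormedSpace ℝ X] : Set (Set X) :=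
  {A | A.Nonempty ∧ Convex ℝ A ∧ IsCompact (toWeakSpace ℝ X '' A)}

/-- Weakly compact sets are norm bounded. -/
theorem exists_norm_le_of_mem_cwk {X : Type*} [NormedAddCommGroup X] [NormedSpace ℝ X]
    {A : Set X} (hA : A ∈ cwk X) : ∃ C : ℝ, ∀ x ∈ A, ‖x‖ ≤ C := by
  obtain ⟨-, -, hc⟩ := hA
  have key : ∀ f : StrongDual ℝ X, ∃ C, ∀ a : A,
      ‖(NormedSpace.inclusionInDoubleDual ℝ X (a : X)) f‖ ≤ C := by
    intro f
    have hcont : Continuous fun y : WeakSpace ℝ X => f ((toWeakSpace ℝ X).symm y) :=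
      WeakBilin.eval_continuous (topDualPairing ℝ X).flip f
    obtain ⟨C, hC⟩ := (hc.image hcont).isBounded.exists_norm_le
    refine ⟨C, fun a => ?_⟩
    have := hC (f (a : X)) ⟨toWeakSpace ℝ X a, ⟨a, a.2, rfl⟩, by simp⟩
    simpa using this
  obtain ⟨C, hC⟩ := banach_steinhaus key
  refine ⟨C, fun x hx => ?_⟩
  have h := hC ⟨x, hx⟩
  have h2 : ‖NormedSpace.inclusionInDoubleDual ℝ X x‖ = ‖x‖ :=
    (NormedSpace.inclusionInDoubleDualLi ℝ (E := X)).norm_map x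
  rwa [h2] at h

/-- The closed unit ball of the dual of `X`. -/
abbrev DualBall (X : Type*) [NormedAddCommGroup X] [NormedSpace ℝ X] : Type _ :=
  Metric.closedBall (0 : StrongDual ℝ X) 1

/-- The Banach space of bounded real functions, with the supremum norm, on the closed unit ball
of the dual of `X`. -/
abbrev EllInfty (X : Type*) [NormedAddCommGroup X] [NormedSpace ℝ X] : Type _ :=
  lp (fun _ : DualBall X => ℝ) ∞

theorem memℓp_supportFunction {X : Type*} [NormedAddCommGroup X] [NormedSpace ℝ X]
    {A : Set X} (hA : A ∈ cwk X) :
    Memℓp (fun f : DualBall X => sSup ((f : StrongDual ℝ X) '' A)) ∞ := by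
  obtain ⟨C, hC⟩ := exists_norm_le_of_mem_cwk hA
  obtain ⟨a, ha⟩ := hA.1
  apply memℓp_infty
  refine ⟨C, ?_⟩
  rintro _ ⟨f, rfl⟩
  have hf : ‖(f : StrongDual ℝ X)‖ ≤ 1 := mem_closedBall_zero_iff.1 f.2
  have hb : ∀ x ∈ A, |(f : StrongDual ℝ X) x| ≤ C := fun x hx => by
    have h1 := (f : StrongDual ℝ X).le_opNorm x
    have h2 := mul_le_mul_of_nonneg_right hf (norm_nonneg x)
    have h3 := hC x hx
    rw [Real.norm_eq_abs] at h1
    linarith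
  simp only [Real.norm_eq_abs, abs_le]
  constructor
  · refine (abs_le.1 (hb a ha)).1.trans (le_csSup ⟨C, ?_⟩ ⟨a, ha, rfl⟩)
    rintro _ ⟨x, hx, rfl⟩
    exact (abs_le.1 (hb x hx)).2
  · refine csSup_le ⟨_, a, ha, rfl⟩ ?_
    rintro _ ⟨x, hx, rfl⟩
    exact (abs_le.1 (hb x hx)).2

/-- The Rådström embedding `j` of `cwk(X)` into the space of bounded functions on the dual unit
ball: `j(A)` is the support function `x* ↦ sup {x*(x) : x ∈ A}`. -/
noncomputable def radstrom {X : Type*} [NormedAddCommGroup X] [NormedSpace ℝ X] (A : cwk X) :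
    EllInfty X :=
  ⟨fun f => sSup ((f : StrongDual ℝ X) '' (A : Set X)), memℓp_supportFunction A.2⟩

/-- A countable partition of `T` into measurable sets of finite measure. Empty members are
allowed (they contribute `0` to every sum), so that finite partitions are included. -/
structure IsPartition {T : Type*} [MeasurableSpace T] (μ : MeasureTheory.Measure T)
    (A : ℕ → Set T) : Prop where
  measurableSet : ∀ n, MeasurableSet (A n)
  disjoint : Pairwise fun m n => Disjoint (A m) (A n)
  iUnion_eq : ⋃ n, A n = Set.univ
  measure_lt_top : ∀ n, μ (A n) < ∞

/-- The partition `A` is finer than `E`: every member of `A` is included in a member of `E`. -/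
def IsFiner {T : Type*} (A E : ℕ → Set T) : Prop :=
  ∀ n, ∃ m, A n ⊆ E m

/-- `t` is a choice of points `t n ∈ A n` in the nonempty members of `A`. -/
def IsTagging {T : Type*} (A : ℕ → Set T) (t : ℕ → T) : Prop :=
  ∀ n, (A n).Nonempty → t n ∈ A n

/-- A multifunction is bounded if all its values lie in one ball about the origin. -/
def IsBoundedMultifunction {T X : Type*} [NormedAddCommGroup X] (F : T → Set X) : Prop :=
  ∃ M : ℝ, ∀ t, ∀ x ∈ F t, ‖x‖ ≤ M

/-- The partial sums `∑_{i < n} F(t_i) μ(A_i)`: norm closures of Minkowski sums. -/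
noncomputable def multiSum {T X : Type*} [MeasurableSpace T] [NormedAddCommGroup X]
    [NormedSpace ℝ X] (μ : MeasureTheory.Measure T) (F : T → Set X) (A : ℕ → Set T) (t : ℕ → T)
    (n : ℕ) : Set X :=
  closure (∑ i ∈ Finset.range n, (μ (A i)).toReal • F (t i))

/-- Simple Birkhoff integrability of `F` in the family `C`. The Hausdorff distance and the upper
limit are taken in `[0, ∞]`. -/
def SimpleBirkhoffIntegrable {T X : Type*} [MeasurableSpace T] [NormedAddCommGroup X]
    [NormedSpace ℝ X] (C : Set (Set X)) (μ : MeasureTheory.Measure T) (F : T → Set X) : Prop :=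
  ∃ I ∈ C, IsClosed I ∧ ∀ ε : ℝ, 0 < ε → ∃ E : ℕ → Set T, IsPartition μ E ∧
    ∀ A : ℕ → Set T, IsPartition μ A → IsFiner A E → ∀ t : ℕ → T, IsTagging A t →
      Filter.limsup (fun n => Metric.hausdorffEDist (multiSum μ F A t n) I) Filter.atTop
        ≤ ENNReal.ofReal ε

/-- The set of all (unconditional) sums `∑ μ(A_n) f(t_n)`, with `t_n ∈ A_n`. -/
def birkhoffSums {T Y : Type*} [MeasurableSpace T] [NormedAddCommGroup Y] [NormedSpace ℝ Y]
    (μ : MeasureTheory.Measure T) (f : T → Y) (A : ℕ → Set T) : Set Y :=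
  {y | ∃ t : ℕ → T, IsTagging A t ∧ HasSum (fun n => (μ (A n)).toReal • f (t n)) y}

/-- `f` is summable with respect to the partition `A`: it is bounded on each member of positive
measure, and all the series `∑ μ(A_n) f(t_n)`, with `t_n ∈ A_n`, converge unconditionally. -/
def IsSummableOn {T Y : Type*} [MeasurableSpace T] [NormedAddCommGroup Y] [NormedSpace ℝ Y]
    (μ : MeasureTheory.Measure T) (f : T → Y) (A : ℕ → Set T) : Prop :=
  (∀ n, 0 < μ (A n) → Bornology.IsBounded (f '' A n)) ∧
    ∀ t : ℕ → T, IsTagging A t → Summable fun n => (μ (A n)).toReal • f (t n)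

/-- Birkhoff integrability of a single-valued function. -/
def BirkhoffIntegrable {T Y : Type*} [MeasurableSpace T] [NormedAddCommGroup Y] [NormedSpace ℝ Y]
    (μ : MeasureTheory.Measure T) (f : T → Y) : Prop :=
  ∀ ε : ℝ, 0 < ε → ∃ A : ℕ → Set T, IsPartition μ A ∧ IsSummableOn μ f A ∧
    Metric.ediam (birkhoffSums μ f A) < ENNReal.ofReal ε

/-- Birkhoff integrability of a `cwk(X)`-valued multifunction: that of its composition with the
Rådström embedding. -/
def MultiBirkhoffIntegrable {T X : Type*} [MeasurableSpace T] [NormedAddCommGroup X]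
    [NormedSpace ℝ X] (μ : MeasureTheory.Measure T) (F : T → cwk X) : Prop :=
  BirkhoffIntegrable μ fun t => radstrom (F t)

end SimpleBirkhoff

namespace SimpleBirkhoff

open Filter Finset MeasureTheory

/-! ### Rearranged series and their tails. -/

section Rearrangement

variable {Y : Type*} [NormedAddCommGroup Y]

/-! Support functions turn Minkowski sums into sums and are controlled by the Hausdorff distance, so
the hypothesis says that the Riemann sums of the bounded function `f = j ∘ F` are eventually
`ε`-close to `J = j(I)` along every partition finer than some `E_ε` (`norm_sum_radstrom_sub_le`).

A partition may be re-enumerated with empty sets inserted, so for a fixed fine partition this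
closeness holds in every order. Hence finite sums outside some finite index set have norm at most
`2ε` (`exists_finset_norm_sum_le`).

Unconditional convergence needs this for all `ε` with one partition. Take `ε_k → 0`, partitions `E
k`, and cut the `j`-th member of `E 0` along the common refinement of `E 0, …, E j`. Outside the
first `k` members of `E 0` this agrees with a partition finer than `E k`; those `k` members have
finite total measure, so there boundedness of `f` gives absolute convergence
(`summable_measure_cut`). The Cauchy criterion follows, and all sums lie in one small ball about
`J`. -/

theorem sum_range_extend {e : ℕ → ℕ} (he : Function.Injective e) (a : ℕ → Y) {L : ℕ}
    {Q : Finset ℕ} (hQ : ∀ n, n ∈ Q ↔ e n < L) :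
    ∑ i ∈ range L, Function.extend e a 0 i = ∑ n ∈ Q, a n := by
  rw [← sum_subset (s₁ := Q.image e), sum_image he.injOn]
  · exact sum_congr rfl fun n _ => he.extend_apply a 0 n
  · intro i hi
    obtain ⟨n, hn, rfl⟩ := mem_image.1 hi
    exact mem_range.2 ((hQ n).1 hn)
  · intro i hi hi'
    rw [Function.extend_apply', Pi.zero_apply]
    rintro ⟨n, rfl⟩
    exact hi' (mem_image_of_mem _ ((hQ n).2 (mem_range.1 hi)))

/-- If the partial sums of all re-enumerations of a series (with zeros inserted) are eventually
`ε`-close to `J`, then the sums over finite sets avoiding some finite set are at most `2ε`. -/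
theorem exists_finset_norm_sum_le {a : ℕ → Y} {J : Y} {ε : ℝ}
    (h : ∀ e : ℕ → ℕ, Function.Injective e →
      ∀ᶠ n in atTop, ‖∑ i ∈ range n, Function.extend e a 0 i - J‖ ≤ ε) :
    ∃ F₀ : Finset ℕ, ∀ S : Finset ℕ, Disjoint S F₀ → ‖∑ n ∈ S, a n‖ ≤ 2 * ε := by
  by_contra! hcon
  choose S hSd hSn using fun N => hcon (range N)
  have hSge : ∀ N, ∀ n ∈ S N, N ≤ n := fun N n hn => by
    have := Finset.disjoint_left.1 (hSd N) hn
    simpa using this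
  -- Block boundaries: the bad set `S (M k)` lies inside the block `[M k, M (k + 1))`.
  let M : ℕ → ℕ := fun k => Nat.rec 0 (fun _ m => max m ((S m).sup id) + 1) k
  have hM0 : M 0 = 0 := rfl
  have hMs : ∀ k, M (k + 1) = max (M k) ((S (M k)).sup id) + 1 := fun k => rfl
  have hMmono : StrictMono M := strictMono_nat_of_lt_succ fun k => by
    rw [hMs]; exact Nat.lt_succ_of_le (le_max_left _ _)
  have hSlt : ∀ k, ∀ n ∈ S (M k), n < M (k + 1) := fun k n hn => by
    rw [hMs]
    exact Nat.lt_succ_of_le ((Finset.le_sup (f := id) hn).trans (le_max_right _ _))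
  have hex : ∀ n, ∃ k, M k ≤ n ∧ n < M (k + 1) := fun n => by
    have hP : ∃ k, n < M k := ⟨n + 1, (Nat.lt_succ_self n).trans_le (hMmono.le_apply)⟩
    have h1 := Nat.find_spec hP
    have h2 : Nat.find hP ≠ 0 := fun h0 => by
      rw [h0, hM0] at h1; omega
    obtain ⟨k, hk⟩ := Nat.exists_eq_succ_of_ne_zero h2
    refine ⟨k, ?_, by rw [hk] at h1; exact h1⟩
    exact not_lt.1 (Nat.find_min hP (by omega))
  choose κ hκ1 hκ2 using hex
  have hle : ∀ {i j}, i ≤ j → M i ≤ M j := fun h => hMmono.monotone h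
  -- The `k`-th block is spread over `[2 * M k, 2 * M (k + 1))`, with the bad set moved before
  -- position `M k + M (k + 1)` and the rest after it. Doubling the length leaves gaps, filled with
  -- zeros, so `e` need only be injective.
  let e : ℕ → ℕ := fun n => if n ∈ S (M (κ n)) then n + M (κ n) else n + M (κ n + 1)
  have he_mem : ∀ n, n ∈ S (M (κ n)) → e n = n + M (κ n) := fun n hn => if_pos hn
  have he_not : ∀ n, n ∉ S (M (κ n)) → e n = n + M (κ n + 1) := fun n hn => if_neg hn
  have he1 : ∀ n, 2 * M (κ n) ≤ e n := fun n => by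
    have h1 := hκ1 n
    have h2 := hle (Nat.le_succ (κ n))
    by_cases hn : n ∈ S (M (κ n))
    · rw [he_mem n hn]; omega
    · rw [he_not n hn]; simp only [Nat.succ_eq_add_one] at h2; omega
  have he2 : ∀ n, e n < 2 * M (κ n + 1) := fun n => by
    have h1 := hκ2 n
    have h2 := hle (Nat.le_succ (κ n))
    simp only [Nat.succ_eq_add_one] at h2
    by_cases hn : n ∈ S (M (κ n))
    · rw [he_mem n hn]; omega
    · rw [he_not n hn]; omega
  have he3 : ∀ n, n ∈ S (M (κ n)) ↔ e n < M (κ n) + M (κ n + 1) := fun n => by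
    have h1 := hκ1 n
    have h2 := hκ2 n
    by_cases hn : n ∈ S (M (κ n))
    · rw [he_mem n hn]; simp only [hn, true_iff]; omega
    · rw [he_not n hn]; simp only [hn, false_iff]; omega
  have hinj : Function.Injective e := fun m n hmn => by
    have hκ : κ m = κ n := by
      rcases lt_trichotomy (κ m) (κ n) with hlt | heq | hlt
      · have := hle (Nat.succ_le_of_lt hlt)
        have h1 := he2 m
        have h2 := he1 n
        simp only [Nat.succ_eq_add_one] at this
        omega
      · exact heq
      · have := hle (Nat.succ_le_of_lt hlt)
        have h1 := he2 n
        have h2 := he1 m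
        simp only [Nat.succ_eq_add_one] at this
        omega
    have hiff : m ∈ S (M (κ m)) ↔ n ∈ S (M (κ n)) := by rw [he3, he3, hmn, hκ]
    by_cases hm : m ∈ S (M (κ m))
    · have h1 := he_mem m hm
      have h2 := he_mem n (hiff.1 hm)
      rw [hκ] at h1; omega
    · have h1 := he_not m hm
      have h2 := he_not n (fun hn => hm (hiff.2 hn))
      rw [hκ] at h1; omega
  have hlow : ∀ k n, n ∈ range (M k) ↔ e n < 2 * M k := fun k n => by
    rw [mem_range]
    have h1 := he1 n
    have h2 := he2 n
    have h3 := hκ1 n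
    have h4 := hκ2 n
    rcases lt_or_ge (κ n) k with hlt | hge
    · have := hle (Nat.succ_le_of_lt hlt)
      simp only [Nat.succ_eq_add_one] at this
      omega
    · have := hle hge
      omega
  have hmid : ∀ k n, n ∈ range (M k) ∪ S (M k) ↔ e n < M k + M (k + 1) := fun k n => by
    rw [mem_union, hlow]
    have hk := hle (Nat.le_succ k)
    simp only [Nat.succ_eq_add_one] at hk
    rcases lt_trichotomy (κ n) k with hlt | rfl | hlt
    · have := hle (Nat.succ_le_of_lt hlt)
      have h2 := he2 n
      simp only [Nat.succ_eq_add_one] at this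
      constructor
      · intro _; omega
      · intro _; left; omega
    · have h1 := he1 n
      rw [← he3]
      constructor
      · rintro (h' | h')
        · omega
        · exact h'
      · exact Or.inr
    · have := hle (Nat.succ_le_of_lt hlt)
      have h1 := he1 n
      simp only [Nat.succ_eq_add_one] at this
      constructor
      · rintro (h' | h')
        · omega
        · have h3 := hSlt k n h'
          have h4 := hκ1 n
          omega
      · intro _; omega
  -- The partial sums up to `2 * M K` and `M K + M (K + 1)` differ exactly by the bad sum, yet both
  -- are `ε`-close to `J`.
  obtain ⟨K, hK⟩ := eventually_atTop.1 (h e hinj)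
  have hKM : K ≤ M K := hMmono.le_apply
  have h1 := hK (2 * M K) (by omega)
  have h2 := hK (M K + M (K + 1)) (by omega)
  rw [sum_range_extend hinj a (hlow K)] at h1
  rw [sum_range_extend hinj a (hmid K), sum_union (hSd (M K)).symm] at h2
  have h3 := hSn (M K)
  have h4 : ∑ n ∈ S (M K), a n = (∑ n ∈ range (M K), a n + ∑ n ∈ S (M K), a n - J)
      - (∑ n ∈ range (M K), a n - J) := by abel
  rw [h4] at h3
  have h5 := norm_sub_le (∑ n ∈ range (M K), a n + ∑ n ∈ S (M K), a n - J)
    (∑ n ∈ range (M K), a n - J)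
  linarith

end Rearrangement

/-! ### Support functions and the Hausdorff distance. -/

section SupportFunction

variable {X : Type*} [NormedAddCommGroup X] [NormedSpace ℝ X]

theorem bddAbove_image_of_norm_le (g : StrongDual ℝ X) {A : Set X} {C : ℝ}
    (hC : ∀ x ∈ A, ‖x‖ ≤ C) : BddAbove (g '' A) := by
  refine ⟨‖g‖ * C, ?_⟩
  rintro _ ⟨x, hx, rfl⟩
  exact (le_abs_self _).trans ((g.le_opNorm x).trans
    (mul_le_mul_of_nonneg_left (hC x hx) (norm_nonneg g)))

theorem sSup_image_le_add {g : StrongDual ℝ X} (hg : ‖g‖ ≤ 1) {P Q : Set X} (hP : P.Nonempty)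
    (hQ : BddAbove (g '' Q)) {r : ℝ} (h : Metric.hausdorffEDist P Q < ENNReal.ofReal r) :
    sSup (g '' P) ≤ sSup (g '' Q) + r := by
  refine csSup_le (hP.image g) ?_
  rintro _ ⟨x, hx, rfl⟩
  obtain ⟨y, hy, hxy⟩ := Metric.exists_edist_lt_of_hausdorffEDist_lt hx h
  rw [edist_dist] at hxy
  have hd : dist x y < r := (ENNReal.ofReal_lt_ofReal_iff'.1 hxy).1
  have h1 : g x - g y ≤ dist x y := by
    rw [← map_sub, dist_eq_norm]
    refine (le_abs_self _).trans ((g.le_opNorm _).trans ?_)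
    simpa using mul_le_mul_of_nonneg_right hg (norm_nonneg (x - y))
  have h2 := le_csSup hQ (Set.mem_image_of_mem g hy)
  linarith

theorem sum_smul_support (g : StrongDual ℝ X) {c : ℕ → ℝ} (hc : ∀ i, 0 ≤ c i) {B : ℕ → Set X}
    (hB : ∀ i, (B i).Nonempty) (hb : ∀ i, BddAbove (g '' B i)) (n : ℕ) :
    (∑ i ∈ range n, c i • B i).Nonempty ∧ BddAbove (g '' ∑ i ∈ range n, c i • B i) ∧
      sSup (g '' ∑ i ∈ range n, c i • B i) = ∑ i ∈ range n, c i * sSup (g '' B i) := by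
  induction n with
  | zero => simp
  | succ n ih =>
    obtain ⟨h1, h2, h3⟩ := ih
    have him : g '' (∑ i ∈ range n, c i • B i + c n • B n) =
        g '' (∑ i ∈ range n, c i • B i) + c n • g '' B n := by
      rw [Set.image_add, Set.image_smul_comm _ _ _ fun x => map_smul g (c n) x]
    have hbs : BddAbove (c n • g '' B n) := (hb n).smul_of_nonneg (hc n)
    rw [sum_range_succ, sum_range_succ, him]
    refine ⟨h1.add (hB n).smul_set, h2.add hbs, ?_⟩
    rw [csSup_add (h1.image g) h2 ((hB n).image g).smul_set hbs, h3,
      Real.sSup_smul_of_nonneg (hc n), smul_eq_mul]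

variable {T : Type*} [MeasurableSpace T]

/-- Each functional of norm at most 1 is 1-Lipschitz, so its suprema over two sets at Hausdorff
distance below `r` differ by at most `r`; the closure in `multiSum` does not affect that distance.
-/
theorem norm_sum_radstrom_sub_le (μ : Measure T) (F : T → cwk X) (A : ℕ → Set T) (t : ℕ → T)
    (I : cwk X) (n : ℕ) {r : ℝ}
    (h : Metric.hausdorffEDist (multiSum μ (fun s => (F s : Set X)) A t n) I
      < ENNReal.ofReal r) :
    ‖∑ i ∈ range n, (μ (A i)).toReal • radstrom (F (t i)) - radstrom I‖ ≤ r := by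
  have hr : 0 ≤ r := (ENNReal.ofReal_pos.1 (bot_le.trans_lt h)).le
  refine lp.norm_le_of_forall_le hr fun g => ?_
  have hg : ‖(g : StrongDual ℝ X)‖ ≤ 1 := mem_closedBall_zero_iff.1 g.2
  rw [multiSum, Metric.hausdorffEDist_closure_left] at h
  have hbd : ∀ C : cwk X, BddAbove ((g : StrongDual ℝ X) '' (C : Set X)) := fun C => by
    obtain ⟨c, hc⟩ := exists_norm_le_of_mem_cwk C.2
    exact bddAbove_image_of_norm_le _ hc
  obtain ⟨h1, h2, h3⟩ := sum_smul_support (g : StrongDual ℝ X)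
    (c := fun i => (μ (A i)).toReal) (fun i => ENNReal.toReal_nonneg)
    (B := fun i => (F (t i) : Set X)) (fun i => (F (t i)).2.1) (fun i => hbd _) n
  have hval : (∑ i ∈ range n, (μ (A i)).toReal • radstrom (F (t i)) - radstrom I : EllInfty X) g
      = ∑ i ∈ range n, (μ (A i)).toReal * sSup ((g : StrongDual ℝ X) '' (F (t i) : Set X))
        - sSup ((g : StrongDual ℝ X) '' (I : Set X)) := by
    rw [lp.coeFn_sub, lp.coeFn_sum]
    exact congrArg (· - sSup ((g : StrongDual ℝ X) '' (I : Set X))) (Finset.sum_apply g (range n)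
      fun i => ⇑((μ (A i)).toReal • radstrom (F (t i))))
  rw [hval, ← h3, Real.norm_eq_abs, abs_le]
  have h4 := sSup_image_le_add hg h1 (hbd I) h
  have h5 := sSup_image_le_add hg I.2.1 h2 (by rwa [Metric.hausdorffEDist_comm])
  constructor <;> linarith

theorem norm_radstrom_le {M : ℝ} {C : cwk X} (h : ∀ x ∈ (C : Set X), ‖x‖ ≤ M) :
    ‖radstrom C‖ ≤ M := by
  obtain ⟨a, ha⟩ := C.2.1
  refine lp.norm_le_of_forall_le ((norm_nonneg a).trans (h a ha)) fun g => ?_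
  have hg : ‖(g : StrongDual ℝ X)‖ ≤ 1 := mem_closedBall_zero_iff.1 g.2
  have hb : ∀ x ∈ (C : Set X), |(g : StrongDual ℝ X) x| ≤ M := fun x hx =>
    ((g : StrongDual ℝ X).le_of_opNorm_le hg x).trans (by simpa using h x hx)
  change |sSup ((g : StrongDual ℝ X) '' (C : Set X))| ≤ M
  rw [abs_le]
  constructor
  · exact (abs_le.1 (hb a ha)).1.trans
      (le_csSup (bddAbove_image_of_norm_le _ h) ⟨a, ha, rfl⟩)
  · refine csSup_le ⟨_, a, ha, rfl⟩ ?_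
    rintro _ ⟨x, hx, rfl⟩
    exact (abs_le.1 (hb x hx)).2

end SupportFunction

/-! ### Re-enumerating and refining partitions. -/

section Partitions

variable {T : Type*}

theorem IsFiner.extend_empty {A E : ℕ → Set T} (hA : IsFiner A E) {e : ℕ → ℕ}
    (he : Function.Injective e) : IsFiner (Function.extend e A fun _ => ∅) E := by
  intro m
  by_cases hm : ∃ n, e n = m
  · obtain ⟨n, rfl⟩ := hm
    rw [he.extend_apply]
    exact hA n
  · rw [Function.extend_apply' _ _ _ hm]
    exact ⟨0, Set.empty_subset _⟩

theorem IsTagging.extend_empty {A : ℕ → Set T} {t : ℕ → T} (ht : IsTagging A t) {e : ℕ → ℕ}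
    (he : Function.Injective e) (t₀ : ℕ → T) :
    IsTagging (Function.extend e A fun _ => ∅) (Function.extend e t t₀) := by
  intro m hne
  by_cases hm : ∃ n, e n = m
  · obtain ⟨n, rfl⟩ := hm
    rw [he.extend_apply] at hne ⊢
    rw [he.extend_apply]
    exact ht n hne
  · rw [Function.extend_apply' _ _ _ hm] at hne
    exact absurd hne (by simp)

theorem IsFiner.trans {A B C : ℕ → Set T} (hAB : IsFiner A B) (hBC : IsFiner B C) :
    IsFiner A C := fun n => by
  obtain ⟨m, hm⟩ := hAB n
  obtain ⟨l, hl⟩ := hBC m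
  exact ⟨l, hm.trans hl⟩

/-- The partition obtained by cutting the `j`-th member of `B` along the partition `C j`. -/
def cut (B : ℕ → Set T) (C : ℕ → ℕ → Set T) (n : ℕ) : Set T :=
  B n.unpair.1 ∩ C n.unpair.1 n.unpair.2

theorem isFiner_cut {B : ℕ → Set T} {C : ℕ → ℕ → Set T} {E : ℕ → Set T}
    (h : ∀ j, IsFiner (C j) E) : IsFiner (cut B C) E := fun n => by
  obtain ⟨m, hm⟩ := h n.unpair.1 n.unpair.2
  exact ⟨m, Set.inter_subset_right.trans hm⟩

/-- The common refinement of `E 0, …, E k`. -/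
def commonRefinement (E : ℕ → ℕ → Set T) : ℕ → ℕ → Set T
  | 0 => E 0
  | k + 1 => cut (commonRefinement E k) fun _ => E (k + 1)

theorem isFiner_commonRefinement (E : ℕ → ℕ → Set T) {j k : ℕ} (h : j ≤ k) :
    IsFiner (commonRefinement E k) (E j) := by
  induction k with
  | zero =>
    obtain rfl : j = 0 := by omega
    exact fun n => ⟨n, subset_rfl⟩
  | succ k ih =>
    rcases Nat.lt_or_ge k j with hk | hk
    · obtain rfl : j = k + 1 := by omega
      exact isFiner_cut fun _ n => ⟨n, subset_rfl⟩
    · exact IsFiner.trans (fun n => ⟨_, Set.inter_subset_left⟩) (ih hk)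

variable [MeasurableSpace T] {μ : Measure T}

theorem IsPartition.extend_empty {A : ℕ → Set T} (hA : IsPartition μ A) {e : ℕ → ℕ}
    (he : Function.Injective e) : IsPartition μ (Function.extend e A fun _ => ∅) := by
  have hcases : ∀ m, (∃ n, e n = m ∧ Function.extend e A (fun _ => ∅) m = A n) ∨
      Function.extend e A (fun _ => ∅) m = ∅ := fun m => by
    by_cases hm : ∃ n, e n = m
    · obtain ⟨n, rfl⟩ := hm
      exact Or.inl ⟨n, rfl, he.extend_apply _ _ _⟩
    · exact Or.inr (Function.extend_apply' _ _ _ hm)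
  refine ⟨fun m => ?_, fun m n hmn => ?_, ?_, fun m => ?_⟩
  · rcases hcases m with ⟨n, -, h⟩ | h <;> rw [h]
    · exact hA.measurableSet n
    · exact MeasurableSet.empty
  · rcases hcases m with ⟨i, rfl, h⟩ | h
    · rcases hcases n with ⟨j, rfl, h'⟩ | h'
      · rw [h, h']
        exact hA.disjoint fun hij => hmn (by rw [hij])
      · simp [h']
    · simp [h]
  · refine Set.eq_univ_of_forall fun x => ?_
    obtain ⟨n, hn⟩ := Set.mem_iUnion.1 (hA.iUnion_eq.symm ▸ Set.mem_univ x)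
    exact Set.mem_iUnion.2 ⟨e n, by rwa [he.extend_apply]⟩
  · rcases hcases m with ⟨n, -, h⟩ | h <;> rw [h]
    · exact hA.measure_lt_top n
    · simp

theorem extend_smul_extend {Y : Type*} [NormedAddCommGroup Y] [NormedSpace ℝ Y] (f : T → Y)
    (A : ℕ → Set T) (t t₀ : ℕ → T) {e : ℕ → ℕ} (he : Function.Injective e) (m : ℕ) :
    (μ (Function.extend e A (fun _ => ∅) m)).toReal • f (Function.extend e t t₀ m) =
      Function.extend e (fun n => (μ (A n)).toReal • f (t n)) 0 m := by
  by_cases hm : ∃ n, e n = m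
  · obtain ⟨n, rfl⟩ := hm
    simp only [he.extend_apply]
  · simp [Function.extend_apply' _ _ _ hm]

theorem IsPartition.cut {B : ℕ → Set T} (hB : IsPartition μ B) {C : ℕ → ℕ → Set T}
    (hC : ∀ j, IsPartition μ (C j)) : IsPartition μ (cut B C) := by
  refine ⟨fun n => (hB.measurableSet _).inter ((hC _).measurableSet _), fun m n hmn => ?_, ?_,
    fun n => (measure_mono Set.inter_subset_left).trans_lt (hB.measure_lt_top _)⟩
  · by_cases h1 : m.unpair.1 = n.unpair.1
    · have h2 : m.unpair.2 ≠ n.unpair.2 := fun h2 => hmn (by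
        rw [← Nat.pair_unpair m, ← Nat.pair_unpair n, h1, h2])
      have := (hC n.unpair.1).disjoint h2
      simp only [SimpleBirkhoff.cut, h1]
      exact this.mono Set.inter_subset_right Set.inter_subset_right
    · exact (hB.disjoint h1).mono Set.inter_subset_left Set.inter_subset_left
  · refine Set.eq_univ_of_forall fun x => ?_
    obtain ⟨j, hj⟩ := Set.mem_iUnion.1 (hB.iUnion_eq.symm ▸ Set.mem_univ x)
    obtain ⟨m, hm⟩ := Set.mem_iUnion.1 ((hC j).iUnion_eq.symm ▸ Set.mem_univ x)
    exact Set.mem_iUnion.2 ⟨Nat.pair j m, by simpa [SimpleBirkhoff.cut] using ⟨hj, hm⟩⟩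

theorem isPartition_commonRefinement {E : ℕ → ℕ → Set T} (hE : ∀ k, IsPartition μ (E k)) :
    ∀ k, IsPartition μ (commonRefinement E k)
  | 0 => hE 0
  | k + 1 => (isPartition_commonRefinement hE k).cut fun _ => hE (k + 1)

/-- The pieces counted are disjoint and lie in the first `k` members of `B`, whose union has finite
measure. -/
theorem summable_measure_cut {B : ℕ → Set T} (hB : IsPartition μ B) {C : ℕ → ℕ → Set T}
    (hC : ∀ j, IsPartition μ (C j)) (k : ℕ) :
    Summable fun n => if n.unpair.1 < k then (μ (cut B C n)).toReal else 0 := by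
  have hP := hB.cut hC
  have hfin : μ (⋃ j ∈ range k, B j) < ∞ :=
    measure_biUnion_lt_top (range k).finite_toSet fun j _ => hB.measure_lt_top j
  have hle : ∑' n, (if n.unpair.1 < k then μ (cut B C n) else 0) ≤ μ (⋃ j ∈ range k, B j) := by
    have hd : Pairwise fun m n => Disjoint (if m.unpair.1 < k then cut B C m else ∅)
        (if n.unpair.1 < k then cut B C n else ∅) := fun m n hmn => by
      have := hP.disjoint hmn
      dsimp only
      split_ifs <;> simp [this]
    have hm : ∀ n, MeasurableSet (if n.unpair.1 < k then cut B C n else ∅) := fun n => by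
      split_ifs
      · exact hP.measurableSet n
      · exact MeasurableSet.empty
    calc _ = ∑' n, μ (if n.unpair.1 < k then cut B C n else ∅) := by
          congr 1; ext n; split_ifs <;> simp
      _ = μ (⋃ n, if n.unpair.1 < k then cut B C n else ∅) := (measure_iUnion hd hm).symm
      _ ≤ _ := by
          refine measure_mono (Set.iUnion_subset fun n => ?_)
          split_ifs with hn
          · exact Set.inter_subset_left.trans
              (Set.subset_biUnion_of_mem (u := B) (Finset.mem_coe.2 (mem_range.2 hn)))
          · exact Set.empty_subset _
  refine (ENNReal.summable_toReal (hle.trans_lt hfin).ne).congr fun n => ?_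
  split_ifs <;> simp

end Partitions

/-! ### The diagonal partition and Birkhoff integrability. -/

section Birkhoff

variable {T : Type*} [MeasurableSpace T] {μ : Measure T} {Y : Type*} [NormedAddCommGroup Y]
  [NormedSpace ℝ Y]

/-- A bounded function with values in a Banach space whose Riemann type sums over sufficiently
fine countable partitions are eventually close to a fixed vector is Birkhoff integrable. -/
theorem birkhoffIntegrable_of_eventually [CompleteSpace Y] {f : T → Y} {M : ℝ}
    (hM : ∀ s, ‖f s‖ ≤ M) (J : Y)
    (h : ∀ ε : ℝ, 0 < ε → ∃ E : ℕ → Set T, IsPartition μ E ∧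
      ∀ A : ℕ → Set T, IsPartition μ A → IsFiner A E → ∀ t : ℕ → T, IsTagging A t →
        ∀ᶠ n in atTop, ‖∑ i ∈ range n, (μ (A i)).toReal • f (t i) - J‖ ≤ ε) :
    BirkhoffIntegrable μ f := by
  intro ε hε
  have hpos : ∀ k : ℕ, 0 < ε / 3 / (k + 1) := fun k => by positivity
  choose E hEp hE using fun k => h _ (hpos k)
  -- `A 0` is the required partition. `A k` is finer than `E k` and differs from `A 0` only inside
  -- the first `k` members of `E 0`.
  let A : ℕ → ℕ → Set T := fun k => cut (E 0) fun j => commonRefinement E (max j k)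
  have hR := isPartition_commonRefinement hEp
  have hAp : ∀ k, IsPartition μ (A k) := fun k => (hEp 0).cut fun j => hR _
  have hAf : ∀ k, IsFiner (A k) (E k) := fun k =>
    isFiner_cut fun j => isFiner_commonRefinement E (le_max_right j k)
  have hAeq : ∀ k n, k ≤ n.unpair.1 → A k n = A 0 n := fun k n hn => by
    simp only [A, cut, max_eq_left hn, Nat.max_zero]
  refine ⟨A 0, hAp 0, ⟨fun n _ => ?_, fun t ht => ?_⟩, ?_⟩
  · refine isBounded_iff_forall_norm_le.2 ⟨M, ?_⟩
    rintro _ ⟨s, -, rfl⟩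
    exact hM s
  · rw [summable_iff_vanishing_norm]
    intro δ hδ
    obtain ⟨k, hk⟩ : ∃ k : ℕ, 2 * (ε / 3 / (k + 1)) < δ / 2 := by
      obtain ⟨k, hk⟩ := exists_nat_gt (4 * ε / (3 * δ))
      refine ⟨k, ?_⟩
      rw [div_lt_iff₀ (by positivity)] at hk
      rw [← mul_div_assoc, div_lt_iff₀ (by positivity)]
      nlinarith
    classical
    -- The tags `t` belong to `A 0`; where `A k` may differ, arbitrary tags replace them, and those
    -- terms are never used.
    let t' : ℕ → T := fun n => if hn : n.unpair.1 < k ∧ (A k n).Nonempty then hn.2.some else t n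
    have ht'eq : ∀ n, k ≤ n.unpair.1 → t' n = t n := fun n hn =>
      dif_neg fun h' => absurd h'.1 (not_lt.2 hn)
    have ht' : IsTagging (A k) t' := fun n hn => by
      rcases lt_or_ge n.unpair.1 k with hlt | hge
      · have : t' n = hn.some := dif_pos ⟨hlt, hn⟩
        rw [this]
        exact hn.some_mem
      · rw [ht'eq n hge, hAeq k n hge]
        exact ht n (hAeq k n hge ▸ hn)
    obtain ⟨F₀, hF₀⟩ := exists_finset_norm_sum_le
      (a := fun n => (μ (A k n)).toReal • f (t' n)) (J := J) (ε := ε / 3 / (k + 1))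
      fun e he => by
        have := hE k _ ((hAp k).extend_empty he) ((hAf k).extend_empty he) _
          (ht'.extend_empty he t')
        simpa only [extend_smul_extend f (A k) t' t' he] using this
    have hu : Summable fun n => if n.unpair.1 < k then (μ (A 0 n)).toReal • f (t n) else 0 := by
      refine Summable.of_norm_bounded
        ((summable_measure_cut (hEp 0) (fun j => hR (max j 0)) k).mul_right M) fun n => ?_
      split_ifs
      · rw [norm_smul, Real.norm_of_nonneg ENNReal.toReal_nonneg]
        exact mul_le_mul_of_nonneg_left (hM _) ENNReal.toReal_nonneg
      · simp
    obtain ⟨F₁, hF₁⟩ := summable_iff_vanishing_norm.1 hu (δ / 2) (half_pos hδ)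
    refine ⟨F₀ ∪ F₁, fun S hS => ?_⟩
    rw [Finset.disjoint_union_right] at hS
    have h1 := hF₁ S hS.2
    have h2 := hF₀ (S.filter fun n => ¬ n.unpair.1 < k) (hS.1.mono_left (filter_subset _ _))
    have h3 : ∑ n ∈ S with ¬ n.unpair.1 < k, (μ (A k n)).toReal • f (t' n) =
        ∑ n ∈ S with ¬ n.unpair.1 < k, (μ (A 0 n)).toReal • f (t n) :=
      sum_congr rfl fun n hn => by
        have := not_lt.1 (mem_filter.1 hn).2
        rw [ht'eq n this, hAeq k n this]
    rw [h3] at h2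
    rw [← sum_filter] at h1
    rw [← sum_filter_add_sum_filter_not S fun n => n.unpair.1 < k]
    refine (norm_add_le _ _).trans_lt ?_
    linarith
  · have hball : birkhoffSums μ f (A 0) ⊆ Metric.closedBall J (ε / 3) := by
      rintro y ⟨t, ht, hy⟩
      rw [mem_closedBall_iff_norm]
      refine le_of_tendsto ((hy.tendsto_sum_nat.sub_const J).norm) ?_
      simpa using hE 0 _ (hAp 0) (hAf 0) t ht
    have hdiam : Metric.ediam (birkhoffSums μ f (A 0)) ≤ ENNReal.ofReal (2 * (ε / 3)) := by
      refine Metric.ediam_le fun x hx y hy => ?_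
      rw [edist_dist]
      refine ENNReal.ofReal_le_ofReal ?_
      have h1 := Metric.mem_closedBall.1 (hball hx)
      have h2 := Metric.mem_closedBall.1 (hball hy)
      have h3 := dist_triangle_right x y J
      linarith
    exact hdiam.trans_lt ((ENNReal.ofReal_lt_ofReal_iff hε).2 (by linarith))

end Birkhoff

end SimpleBirkhoff

theorem theorem3p15 {T X : Type*} [MeasurableSpace T] [NormedAddCommGroup X] [NormedSpace ℝ X]
    [CompleteSpace X] (μ : MeasureTheory.Measure T) [MeasureTheory.SigmaFinite μ]
    (F : T → SimpleBirkhoff.cwk X)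
    (hbdd : SimpleBirkhoff.IsBoundedMultifunction fun t => (F t : Set X))
    (hF : SimpleBirkhoff.SimpleBirkhoffIntegrable (SimpleBirkhoff.cwk X) μ
      fun t => (F t : Set X)) :
    SimpleBirkhoff.MultiBirkhoffIntegrable μ F := by
  obtain ⟨M, hM⟩ := hbdd
  obtain ⟨I, hI, -, h⟩ := hF
  refine SimpleBirkhoff.birkhoffIntegrable_of_eventually
    (fun s => SimpleBirkhoff.norm_radstrom_le (hM s)) (SimpleBirkhoff.radstrom ⟨I, hI⟩)
    fun ε hε => ?_
  -- Halving makes the upper limit strictly less than `ε`, so that the distances are eventually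
  -- below `ε`.
  obtain ⟨E, hE, hE'⟩ := h (ε / 2) (half_pos hε)
  refine ⟨E, hE, fun A hA hAE t ht => ?_⟩
  have hlt := (hE' A hA hAE t ht).trans_lt
    ((ENNReal.ofReal_lt_ofReal_iff hε).2 (half_lt_self hε))
  filter_upwards [Filter.eventually_lt_of_limsup_lt hlt] with n hn
  exact SimpleBirkhoff.norm_sum_radstrom_sub_le μ F A t ⟨I, hI⟩ n hn
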